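/- An \emph{extended contact algebra} (ECA) is a Boolean algebra $\mathbf A$ with $0\neq 1$ together with a ternary relation $(a,b)\vdash c$ on $A$ such that, for all $a,b,d,e,f\in A$: if $(a,b)\vdash f$ then $(a\vee d,b)\vdash f\vee d$; if $(a,b)\vdash d$, $(a,b)\vdash e$ and $(d,e)\vdash f$ then $(a,b)\vdash f$; $(a,b)\vdash a\vee f$; if $(a,a)\vdash f$ then $a\le f$; if $(a,b)\vdash f$ then $(b,a)\vdash f$. A Boolean homomorphism $h\colon\mathbf A\to\mathbf B$ between ECAs is a \emph{reflecting ECA-morphism} if $(h(a),h(b))\vdash h(c)$ implies $(a,b)\vdash c$, a \emph{preserving ECA-morphism} if $(a,b)\vdash c$ implies $(h(a),h(b))\vdash h(c)$, and a \emph{similarity ECA-morphism} if it is both. Let $\mathsf{EC}_0,\mathsf{EC}_1,\mathsf{EC}_2$ be the categories of ECAs with reflecting, preserving and similarity ECA-morphisms, respectively. For a Boolean space $X$ (compact, Hausdorff, totally disconnected) let $\mathscr C_0(X)$ be the set of non-empty closed subsets and $\mathscr{CO}(X)$ the set of clopen subsets of $X$. For $\vec U=(U_1,U_2,U_3)\in\mathscr{CO}(X)^3$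 let $L_{\vec U}$ be the set of $\vec Y\in\mathscr C_0(X)^3$ with $Y_i\cap U_i\ne\emptyset$ for some $i$. For $R\subseteq X\times\mathscr C_0(X)^3$ put $R(x)=\{\vec Y:(x,\vec Y)\in R\}$, $R^{-1}(\vec Y)=\{x:(x,\vec Y)\in R\}$ (so $R^{-1}(\vec Y)=\emptyset$ if some $Y_i$ is empty), $\Diamond_R(\vec U)=\{x: \exists\,\vec Y\in R(x),\ Y_i\subseteq U_i \text{ for } i=1,2,3\}$ and $\Box_R(\vec U)=\{x:R(x)\subseteq L_{\vec U}\}$. A \emph{PSI-space} is a triple $(X,\tau,R)$ with $(X,\tau)$ a Boolean space and $R\subseteq X\times\mathscr C_0(X)^3$ such that (DF1) $\Diamond_R(\vec U)\in\mathscr{CO}(X)$ for all $\vec U\in\mathscr{CO}(X)^3$; (DF2) $R(x)=\bigcap\{L_{\vec U}:\vec U\in\mathscr{CO}(X)^3,\ x\in\Box_R(\vec U)\}$ for all $x\in X$; (DF3) if $\vec Y\in R(x)$, then $(\{y_1\},\{y_2\},Y_3)\in R(x)$ for some $y_1\in Y_1$, $y_2\in Y_2$; and for all $Y_1,Y_2,Y_3,Z,W\in\mathscr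 C_0(X)$: (PIF1) $R^{-1}(Y_1,Y_2,Y_3)\subseteq R^{-1}(Y_1,Y_2,Z)\cup R^{-1}(Y_1,Y_2,W)\cup R^{-1}(\mathrm{cl}(Z^c),\mathrm{cl}(W^c),Y_3)$; (PIF2) if $Y_1\cap Y_3=\emptyset$, then $R^{-1}(Y_1,Y_2,Y_3)=\emptyset$; (PIF3) $Y_1\cap Y_2\subseteq R^{-1}(Y_1,Y_1,Y_2)$; (PIF4) $R^{-1}(Y_1,Y_2,Y_3)\subseteq R^{-1}(Y_2,Y_1,Y_3)$. It is \emph{total} if, for every $\vec Z\in\mathscr C_0(X)^3$, $(x,\vec Z)\in R$ for some $x\in X$ implies $(y,\vec Z)\in R$ for all $y\in X$. Let $f\colon X_1\to X_2$ be a function between PSI-spaces such that $f^{-1}[U]\in\mathscr{CO}(X_1)$ for all $U\in\mathscr{CO}(X_2)$. It is a \emph{semi-PSI map} if, whenever $(f(x),\vec Z)\in R_2$, there is $\vec Y\in R_1(x)$ with $f[Y_i]\subseteq Z_i$ for $i=1,2,3$; it is a \emph{hemi-PSI map} if $(x,\vec Y)\in R_1$ implies $(f(x),(f[Y_1],f[Y_2],f[Y_3]))\in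 R_2$; it is a \emph{PSI map} if it is both. Let $\mathsf{PSISp}_0,\mathsf{PSISp}_1,\mathsf{PSISp}_2$ be the categories of PSI-spaces with semi-PSI maps, hemi-PSI maps and PSI maps, respectively, and let $\mathsf{tPSISp}_j$ be the full subcategory of $\mathsf{PSISp}_j$ on the non-empty total PSI-spaces. \textbf{Theorem.} The categories $\mathsf{EC}_0$, $\mathsf{EC}_1$ and $\mathsf{EC}_2$ are dually equivalent to $\mathsf{tPSISp}_0$, $\mathsf{tPSISp}_1$ and $\mathsf{tPSISp}_2$, respectively. -/

import Mathlib

open CategoryTheory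

universe u

namespace ExtContact

/-! ## Extended contact algebras and their morphisms -/

/-- An extended contact algebra: a non-degenerate Boolean algebra with a ternary relation
`Ent a b c`, read `(a, b) ⊢ c`. -/
structure ECA : Type (u + 1) where
  carrier : Type u
  [boolAlg : BooleanAlgebra carrier]
  [nontriv : Nontrivial carrier]
  Ent : carrier → carrier → carrier → Prop
  ec0 : ∀ a b d f, Ent a b f → Ent (a ⊔ d) b (f ⊔ d)
  ec1 : ∀ a b d e f, Ent a b d → Ent a b e → Ent d e f → Ent a b f
  ec2 : ∀ a b f, Ent a b (a ⊔ f)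
  ec3 : ∀ a f, Ent a a f → a ≤ f
  ec4 : ∀ a b f, Ent a b f → Ent b a f

instance : CoeSort ECA.{u} (Type u) := ⟨ECA.carrier⟩

instance (A : ECA.{u}) : BooleanAlgebra A := A.boolAlg

instance (A : ECA.{u}) : Nontrivial A := A.nontriv

/-- A Boolean homomorphism that reflects `⊢`. -/
def IsReflecting {A B : ECA.{u}} (h : BoundedLatticeHom A B) : Prop :=
  ∀ a b c : A, B.Ent (h a) (h b) (h c) → A.Ent a b c

/-- A Boolean homomorphism that preserves `⊢`. -/
def IsPreserving {A B : ECA.{u}} (h : BoundedLatticeHom A B) : Prop :=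
  ∀ a b c : A, A.Ent a b c → B.Ent (h a) (h b) (h c)

/-- A Boolean homomorphism that both reflects and preserves `⊢`. -/
def IsSimilarity {A B : ECA.{u}} (h : BoundedLatticeHom A B) : Prop :=
  IsReflecting h ∧ IsPreserving h

/-- Objects of the category of extended contact algebras with reflecting ECA-morphisms. -/
structure EC0 : Type (u + 1) where
  toECA : ECA.{u}

/-- Objects of the category of extended contact algebras with preserving ECA-morphisms. -/
structure EC1 : Type (u + 1) where
  toECA : ECA.{u}

/-- Objects of the category of extended contact algebras with similarity ECA-morphisms. -/
structure EC2 : Type (u + 1) where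
  toECA : ECA.{u}

instance : Category.{u} EC0.{u} where
  Hom A B := { h : BoundedLatticeHom A.toECA B.toECA // IsReflecting h }
  id A := ⟨BoundedLatticeHom.id _, fun _ _ _ h => h⟩
  comp f g := ⟨g.1.comp f.1, fun a b c h => f.2 a b c (g.2 _ _ _ h)⟩

instance : Category.{u} EC1.{u} where
  Hom A B := { h : BoundedLatticeHom A.toECA B.toECA // IsPreserving h }
  id A := ⟨BoundedLatticeHom.id _, fun _ _ _ h => h⟩
  comp f g := ⟨g.1.comp f.1, fun a b c h => g.2 _ _ _ (f.2 a b c h)⟩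

instance : Category.{u} EC2.{u} where
  Hom A B := { h : BoundedLatticeHom A.toECA B.toECA // IsSimilarity h }
  id A := ⟨BoundedLatticeHom.id _, fun _ _ _ h => h, fun _ _ _ h => h⟩
  comp f g := ⟨g.1.comp f.1, fun a b c h => f.2.1 a b c (g.2.1 _ _ _ h),
    fun a b c h => g.2.2 _ _ _ (f.2.2 a b c h)⟩

/-! ## Pseudo-inference spaces

A relation between points of `X` and triples of non-empty closed subsets of `X` is represented
by `R : X → Set X → Set X → Set X → Prop`; that it only relates points to triples of non-empty
closed sets is a clause of `IsPSIFrame`. -/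

/-- Membership in the family of non-empty closed subsets of `X`. -/
def IsClosed0 {X : Type u} [TopologicalSpace X] (Y : Set X) : Prop :=
  IsClosed Y ∧ Y.Nonempty

/-- `(Y₁, Y₂, Y₃)` meets `(U₁, U₂, U₃)` in at least one coordinate, i.e. it belongs to `L_U`. -/
def Meets {X : Type u} (Y₁ Y₂ Y₃ U₁ U₂ U₃ : Set X) : Prop :=
  (Y₁ ∩ U₁).Nonempty ∨ (Y₂ ∩ U₂).Nonempty ∨ (Y₃ ∩ U₃).Nonempty

/-- `◇_R(U)`: the points `x` such that some triple in `R(x)` lies outside `L_{Uᶜ}`. -/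
def diamondR {X : Type u} (R : X → Set X → Set X → Set X → Prop) (U₁ U₂ U₃ : Set X) : Set X :=
  {x | ∃ Y₁ Y₂ Y₃, R x Y₁ Y₂ Y₃ ∧ ¬ Meets Y₁ Y₂ Y₃ U₁ᶜ U₂ᶜ U₃ᶜ}

/-- `□_R(U)`: the points `x` such that `R(x) ⊆ L_U`. -/
def boxR {X : Type u} (R : X → Set X → Set X → Set X → Prop) (U₁ U₂ U₃ : Set X) : Set X :=
  {x | ∀ Y₁ Y₂ Y₃, R x Y₁ Y₂ Y₃ → Meets Y₁ Y₂ Y₃ U₁ U₂ U₃}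

/-- `R⁻¹(Y₁, Y₂, Y₃)`. -/
def preR {X : Type u} (R : X → Set X → Set X → Set X → Prop) (Y₁ Y₂ Y₃ : Set X) : Set X :=
  {x | R x Y₁ Y₂ Y₃}

/-- The axioms of a descriptive PSI-frame on a topological space. -/
structure IsPSIFrame (X : Type u) [TopologicalSpace X]
    (R : X → Set X → Set X → Set X → Prop) : Prop where
  closed0 : ∀ x Y₁ Y₂ Y₃, R x Y₁ Y₂ Y₃ → IsClosed0 Y₁ ∧ IsClosed0 Y₂ ∧ IsClosed0 Y₃
  df1 : ∀ U₁ U₂ U₃ : Set X, IsClopen U₁ → IsClopen U₂ → IsClopen U₃ →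
    IsClopen (diamondR R U₁ U₂ U₃)
  df2 : ∀ (x : X) (Y₁ Y₂ Y₃ : Set X), IsClosed0 Y₁ → IsClosed0 Y₂ → IsClosed0 Y₃ →
    (R x Y₁ Y₂ Y₃ ↔ ∀ U₁ U₂ U₃ : Set X, IsClopen U₁ → IsClopen U₂ → IsClopen U₃ →
      x ∈ boxR R U₁ U₂ U₃ → Meets Y₁ Y₂ Y₃ U₁ U₂ U₃)
  df3 : ∀ x Y₁ Y₂ Y₃, R x Y₁ Y₂ Y₃ → ∃ y₁ ∈ Y₁, ∃ y₂ ∈ Y₂, R x {y₁} {y₂} Y₃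

/-- The axioms of a pseudo-inference space on a topological space. -/
structure IsPSISpace (X : Type u) [TopologicalSpace X]
    (R : X → Set X → Set X → Set X → Prop) : Prop extends IsPSIFrame X R where
  pif1 : ∀ Y₁ Y₂ Y₃ Z W : Set X, IsClosed0 Y₁ → IsClosed0 Y₂ → IsClosed0 Y₃ →
    IsClosed0 Z → IsClosed0 W →
    preR R Y₁ Y₂ Y₃ ⊆ preR R Y₁ Y₂ Z ∪ preR R Y₁ Y₂ W ∪ preR R (closure Zᶜ) (closure Wᶜ) Y₃
  pif2 : ∀ Y₁ Y₂ Y₃ : Set X, IsClosed0 Y₁ → IsClosed0 Y₂ → IsClosed0 Y₃ →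
    Y₁ ∩ Y₃ = ∅ → preR R Y₁ Y₂ Y₃ = ∅
  pif3 : ∀ Y₁ Y₂ : Set X, IsClosed0 Y₁ → IsClosed0 Y₂ → Y₁ ∩ Y₂ ⊆ preR R Y₁ Y₁ Y₂
  pif4 : ∀ Y₁ Y₂ Y₃ : Set X, IsClosed0 Y₁ → IsClosed0 Y₂ → IsClosed0 Y₃ →
    preR R Y₁ Y₂ Y₃ ⊆ preR R Y₂ Y₁ Y₃

/-- A pseudo-inference space: a Boolean space with a relation satisfying the axioms. -/
structure PSISpace : Type (u + 1) where
  carrier : Type u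
  [top : TopologicalSpace carrier]
  [compact : CompactSpace carrier]
  [t2 : T2Space carrier]
  [totDisc : TotallyDisconnectedSpace carrier]
  R : carrier → Set carrier → Set carrier → Set carrier → Prop
  isPSI : IsPSISpace carrier R

instance : CoeSort PSISpace.{u} (Type u) := ⟨PSISpace.carrier⟩

instance (X : PSISpace.{u}) : TopologicalSpace X := X.top

instance (X : PSISpace.{u}) : CompactSpace X := X.compact

instance (X : PSISpace.{u}) : T2Space X := X.t2

instance (X : PSISpace.{u}) : TotallyDisconnectedSpace X := X.totDisc

/-- Preimages of clopen sets are clopen. -/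
def PullsBackClopens {X₁ X₂ : PSISpace.{u}} (f : X₁ → X₂) : Prop :=
  ∀ U : Set X₂, IsClopen U → IsClopen (f ⁻¹' U)

/-- The forth condition: `R₁(x, Y)` implies `R₂(f x, f[Y])`. -/
def Forth {X₁ X₂ : PSISpace.{u}} (f : X₁ → X₂) : Prop :=
  ∀ (x : X₁) (Y₁ Y₂ Y₃ : Set X₁), X₁.R x Y₁ Y₂ Y₃ → X₂.R (f x) (f '' Y₁) (f '' Y₂) (f '' Y₃)

/-- The back condition: `R₂(f x, Z)` implies `R₁(x, Y)` for some `Y` with `f[Y] ⊆ Z`. -/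
def Back {X₁ X₂ : PSISpace.{u}} (f : X₁ → X₂) : Prop :=
  ∀ (x : X₁) (Z₁ Z₂ Z₃ : Set X₂), X₂.R (f x) Z₁ Z₂ Z₃ →
    ∃ Y₁ Y₂ Y₃ : Set X₁, X₁.R x Y₁ Y₂ Y₃ ∧ f '' Y₁ ⊆ Z₁ ∧ f '' Y₂ ⊆ Z₂ ∧ f '' Y₃ ⊆ Z₃

/-- Semi-PSI maps are the duals of semi-homomorphisms, hence of reflecting ECA-morphisms;
the condition dual to these is the back condition. -/
def IsSemiPSIMap {X₁ X₂ : PSISpace.{u}} (f : X₁ → X₂) : Prop :=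
  PullsBackClopens f ∧ Back f

/-- Hemi-PSI maps are the duals of hemi-homomorphisms, hence of preserving ECA-morphisms;
the condition dual to these is the forth condition. -/
def IsHemiPSIMap {X₁ X₂ : PSISpace.{u}} (f : X₁ → X₂) : Prop :=
  PullsBackClopens f ∧ Forth f

/-- PSI maps: both semi-PSI and hemi-PSI. -/
def IsPSIMap {X₁ X₂ : PSISpace.{u}} (f : X₁ → X₂) : Prop :=
  IsSemiPSIMap f ∧ IsHemiPSIMap f

theorem isSemiPSIMap_id (X : PSISpace.{u}) : IsSemiPSIMap (id : X → X) :=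
  ⟨fun _ h => h, fun _ Z₁ Z₂ Z₃ h => ⟨Z₁, Z₂, Z₃, h, by simp, by simp, by simp⟩⟩

theorem isHemiPSIMap_id (X : PSISpace.{u}) : IsHemiPSIMap (id : X → X) :=
  ⟨fun _ h => h, fun _ _ _ _ h => by simpa using h⟩

theorem IsSemiPSIMap.comp {X₁ X₂ X₃ : PSISpace.{u}} {g : X₂ → X₃} {f : X₁ → X₂}
    (hg : IsSemiPSIMap g) (hf : IsSemiPSIMap f) : IsSemiPSIMap (g ∘ f) := by
  refine ⟨fun U hU => hf.1 _ (hg.1 U hU), fun x Z₁ Z₂ Z₃ h => ?_⟩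
  obtain ⟨W₁, W₂, W₃, hW, h₁, h₂, h₃⟩ := hg.2 (f x) Z₁ Z₂ Z₃ h
  obtain ⟨Y₁, Y₂, Y₃, hY, k₁, k₂, k₃⟩ := hf.2 x W₁ W₂ W₃ hW
  refine ⟨Y₁, Y₂, Y₃, hY, ?_, ?_, ?_⟩ <;> rw [Set.image_comp]
  · exact (Set.image_mono k₁).trans h₁
  · exact (Set.image_mono k₂).trans h₂
  · exact (Set.image_mono k₃).trans h₃

theorem IsHemiPSIMap.comp {X₁ X₂ X₃ : PSISpace.{u}} {g : X₂ → X₃} {f : X₁ → X₂}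
    (hg : IsHemiPSIMap g) (hf : IsHemiPSIMap f) : IsHemiPSIMap (g ∘ f) := by
  refine ⟨fun U hU => hf.1 _ (hg.1 U hU), fun x Y₁ Y₂ Y₃ h => ?_⟩
  simp only [Set.image_comp]
  exact hg.2 _ _ _ _ (hf.2 x Y₁ Y₂ Y₃ h)

/-- Objects of the category of PSI-spaces with semi-PSI maps. -/
structure PSISp0 : Type (u + 1) where
  toPSISpace : PSISpace.{u}

/-- Objects of the category of PSI-spaces with hemi-PSI maps. -/
structure PSISp1 : Type (u + 1) where
  toPSISpace : PSISpace.{u}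

/-- Objects of the category of PSI-spaces with PSI maps. -/
structure PSISp2 : Type (u + 1) where
  toPSISpace : PSISpace.{u}

instance : Category.{u} PSISp0.{u} where
  Hom X Y := { f : X.toPSISpace → Y.toPSISpace // IsSemiPSIMap f }
  id X := ⟨id, isSemiPSIMap_id _⟩
  comp f g := ⟨g.1 ∘ f.1, g.2.comp f.2⟩

instance : Category.{u} PSISp1.{u} where
  Hom X Y := { f : X.toPSISpace → Y.toPSISpace // IsHemiPSIMap f }
  id X := ⟨id, isHemiPSIMap_id _⟩
  comp f g := ⟨g.1 ∘ f.1, g.2.comp f.2⟩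

instance : Category.{u} PSISp2.{u} where
  Hom X Y := { f : X.toPSISpace → Y.toPSISpace // IsPSIMap f }
  id X := ⟨id, isSemiPSIMap_id _, isHemiPSIMap_id _⟩
  comp f g := ⟨g.1 ∘ f.1, g.2.1.comp f.2.1, g.2.2.comp f.2.2⟩

/-- A PSI-space is total if each triple of non-empty closed sets related to some point is related
to every point. -/
def PSISpace.IsTotal (X : PSISpace.{u}) : Prop :=
  ∀ Z₁ Z₂ Z₃ : Set X, IsClosed0 Z₁ → IsClosed0 Z₂ → IsClosed0 Z₃ →
    (∃ x : X, X.R x Z₁ Z₂ Z₃) → ∀ y : X, X.R y Z₁ Z₂ Z₃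

/-- Full subcategory of `PSISp0` on the non-empty total PSI-spaces (non-emptiness corresponds to
non-degeneracy of extended contact algebras). -/
abbrev TPSISp0 : Type (u + 1) :=
  ObjectProperty.FullSubcategory
    (fun X : PSISp0.{u} => Nonempty X.toPSISpace ∧ X.toPSISpace.IsTotal)

/-- Full subcategory of `PSISp1` on the non-empty total PSI-spaces. -/
abbrev TPSISp1 : Type (u + 1) :=
  ObjectProperty.FullSubcategory
    (fun X : PSISp1.{u} => Nonempty X.toPSISpace ∧ X.toPSISpace.IsTotal)

/-- Full subcategory of `PSISp2` on the non-empty total PSI-spaces. -/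
abbrev TPSISp2 : Type (u + 1) :=
  ObjectProperty.FullSubcategory
    (fun X : PSISp2.{u} => Nonempty X.toPSISpace ∧ X.toPSISpace.IsTotal)

end ExtContact

namespace ExtContact

open TopologicalSpace Set Opposite

/-! ## Elementary properties of extended contact algebras -/

namespace ECA

variable {A : ECA.{u}} {a a' b b' c c' : A}

/-! Stone duality between Boolean algebras and Boolean spaces is enriched with the ternary
relations. In a total PSI-space the relation on triples of closed sets does not depend on the point.
Declare `(U, V) ⊢ W` for clopen sets when every related triple with `Y₁ ⊆ U` and `Y₂ ⊆ V` has `Y₃`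
meeting `W`. The clopen algebra is then an ECA (`ent_sup`, `ent_cut`), and DF2 says precisely that
the relation is recovered from `⊢` by the same formula (`IsTotal.rel_iff`).

Conversely, for an ECA the same formula read on the Stone space defines `StoneRel`. The cut rule
gives PIF1, and compactness gives DF3. No information is lost: if `(a, b) ⊢ c` fails, the triple of
clopen sets of `a`, `b` and `cᶜ` is itself related and witnesses the failure (`ECA.ent_rep_iff`).

For morphisms, a continuous map satisfies the forth condition iff its preimage homomorphism
preserves `⊢` (`forth_iff`), and the back condition iff it reflects `⊢` (`back_iff`). So in each of
the three settings the clopen functor is faithful and full by Stone duality for maps, and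
essentially surjective because the Stone representation is a similarity isomorphism. -/

theorem ent_of_le_left (b : A) (h : a ≤ c) : A.Ent a b c := by
  simpa [sup_eq_right.2 h] using A.ec2 a b c

theorem ent_of_le_right (a : A) (h : b ≤ c) : A.Ent a b c :=
  A.ec4 _ _ _ (ent_of_le_left a h)

theorem ent_mono (ha : a ≤ a') (hb : b ≤ b') (hc : c' ≤ c) (h : A.Ent a' b' c') :
    A.Ent a b c := by
  have h' : A.Ent a b c' := A.ec1 a b a' b' c' (ent_of_le_left b ha) (ent_of_le_right a hb) h
  -- A second cut, on the pair `(c', c')`, weakens the conclusion.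
  exact A.ec1 a b c' c' c h' h' (ent_of_le_left c' hc)

/-- Two cases are joined by a cut: `ec0` turns the first hypothesis into `(a ⊔ a', b) ⊢ c ⊔ a'` and
the second into `(c ⊔ a', b) ⊢ c`, as `c ⊔ c = c`. This lets finitely many failures be merged in the
compactness argument for DF3. -/
theorem ent_sup_left (h : A.Ent a b c) (h' : A.Ent a' b c) : A.Ent (a ⊔ a') b c := by
  have h₂ : A.Ent (c ⊔ a') b c := by
    simpa [sup_comm] using A.ec0 a' b c c h'
  exact A.ec1 (a ⊔ a') b (c ⊔ a') b c (A.ec0 a b a' c h) (ent_of_le_right _ le_rfl) h₂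

end ECA

/-! ## The algebra of clopen sets of a total PSI-space -/

theorem isClosed0_singleton {X : Type u} [TopologicalSpace X] [T1Space X] (x : X) :
    IsClosed0 ({x} : Set X) :=
  ⟨isClosed_singleton, singleton_nonempty x⟩

namespace PSISpace

/-- The inference relation on the clopen sets of a PSI-space. -/
def Ent (X : PSISpace.{u}) (U V W : Clopens X) : Prop :=
  ∀ (x : X) (Y₁ Y₂ Y₃ : Set X), X.R x Y₁ Y₂ Y₃ → Y₁ ⊆ U → Y₂ ⊆ V → (Y₃ ∩ W).Nonempty

variable {X : PSISpace.{u}}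

theorem inter_nonempty_of_rel {x : X} {Y₁ Y₂ Y₃ : Set X} (h : X.R x Y₁ Y₂ Y₃) :
    (Y₁ ∩ Y₃).Nonempty := by
  by_contra hne
  obtain ⟨h₁, h₂, h₃⟩ := X.isPSI.closed0 _ _ _ _ h
  have := X.isPSI.pif2 Y₁ Y₂ Y₃ h₁ h₂ h₃ (not_nonempty_iff_eq_empty.1 hne)
  have hx : x ∈ preR X.R Y₁ Y₂ Y₃ := h
  rw [this] at hx
  exact hx

theorem rel_swap {x : X} {Y₁ Y₂ Y₃ : Set X} (h : X.R x Y₁ Y₂ Y₃) : X.R x Y₂ Y₁ Y₃ := by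
  obtain ⟨h₁, h₂, h₃⟩ := X.isPSI.closed0 _ _ _ _ h
  exact X.isPSI.pif4 Y₁ Y₂ Y₃ h₁ h₂ h₃ h

theorem rel_singleton (x : X) : X.R x {x} {x} {x} :=
  X.isPSI.pif3 {x} {x} (isClosed0_singleton x) (isClosed0_singleton x) (by simp)

/-- A clopen set that meets the third coordinate of every triple over `{y₁}, {y₂}` contains the
complement of a non-empty closed set unrelated to `{y₁}, {y₂}`. -/
theorem exists_not_rel {x y₁ y₂ z : X} (hz : z ≠ y₁) (D : Clopens X)
    (hD : ∀ Y, X.R x {y₁} {y₂} Y → (Y ∩ D).Nonempty) :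
    ∃ Z, IsClosed0 Z ∧ closure Zᶜ ⊆ D ∧ ¬ X.R x {y₁} {y₂} Z := by
  by_cases hne : ((D : Set X)ᶜ).Nonempty
  · refine ⟨(D : Set X)ᶜ, ⟨D.isOpen.isClosed_compl, hne⟩, ?_, fun h => ?_⟩
    · rw [compl_compl, D.isClosed.closure_eq]
    · obtain ⟨y, hy, hy'⟩ := hD _ h
      exact hy hy'
  -- The complement of `D` is empty, hence not an admissible closed set. The singleton of `z`
  -- replaces it, being unrelated by PIF2 because it misses `{y₁}`.
  · have hD' : (D : Set X) = univ := by
      rwa [not_nonempty_iff_eq_empty, compl_empty_iff] at hne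
    refine ⟨{z}, isClosed0_singleton z, by simp [hD'], fun h => ?_⟩
    obtain ⟨y, rfl, hy⟩ := inter_nonempty_of_rel h
    exact hz hy.symm

/-- DF3 shrinks `Y₁` to a point `y`, which PIF2 puts in `Y₃`. If `Y₃` misses `D`, then `y` must lie
in `U`, so the hypothesis applies to the shrunken triple. -/
theorem ent_sup {U V W D : Clopens X} (h : X.Ent U V W) : X.Ent (U ⊔ D) V (W ⊔ D) := by
  intro x Y₁ Y₂ Y₃ hR hU hV
  by_contra hne
  obtain ⟨y₁, hy₁, y₂, hy₂, hR'⟩ := X.isPSI.df3 _ _ _ _ hR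
  obtain ⟨y, hy, hy₃⟩ := inter_nonempty_of_rel hR'
  obtain rfl : y = y₁ := hy
  have hyU : y ∈ (U : Set X) := by
    rcases hU hy₁ with h | h
    · exact h
    · exact absurd ⟨y, hy₃, Or.inr h⟩ hne
  obtain ⟨w, hw, hw'⟩ := h x {y} {y₂} Y₃ hR' (by simpa using hyU) (by simpa using hV hy₂)
  exact hne ⟨w, hw, Or.inl hw'⟩

/-- PIF1 with `Z` and `W` taken as the complements of `D` and `E`: the first two alternatives
contradict the premises, and the third triple lies below `D` and `E`. -/
theorem ent_cut {U V W D E : Clopens X} (hD : X.Ent U V D) (hE : X.Ent U V E)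
    (hW : X.Ent D E W) : X.Ent U V W := by
  intro x Y₁ Y₂ Y₃ hR hU hV
  obtain ⟨y₁, hy₁, y₂, hy₂, hR'⟩ := X.isPSI.df3 _ _ _ _ hR
  have hU' : ({y₁} : Set X) ⊆ U := by simpa using hU hy₁
  have hV' : ({y₂} : Set X) ⊆ V := by simpa using hV hy₂
  by_cases hX : ∃ z, z ≠ y₁
  · obtain ⟨z, hz⟩ := hX
    obtain ⟨Z, hZ, hZD, hZR⟩ := exists_not_rel hz D fun Y h => hD x _ _ Y h hU' hV'
    obtain ⟨Z', hZ', hZE, hZR'⟩ := exists_not_rel hz E fun Y h => hE x _ _ Y h hU' hV'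
    have hx := X.isPSI.pif1 {y₁} {y₂} Y₃ Z Z' (isClosed0_singleton _) (isClosed0_singleton _)
      (X.isPSI.closed0 _ _ _ _ hR).2.2 hZ hZ' hR'
    rcases hx with (h | h) | h
    · exact absurd h hZR
    · exact absurd h hZR'
    · exact hW x _ _ _ h hZD hZE
  -- In a one-point space no second point is available to stand in for an empty complement, but then
  -- the premises put that point in both `D` and `E`.
  · push Not at hX
    obtain ⟨d, -, hd⟩ := hD x _ _ _ hR' hU' hV'
    obtain ⟨e, -, he⟩ := hE x _ _ _ hR' hU' hV'
    refine hW x _ _ _ hR' ?_ ?_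
    · rw [hX d] at hd
      simpa using hd
    · rw [hX e, ← hX y₂] at he
      simpa using he

/-- The extended contact algebra of clopen sets of a non-empty PSI-space. -/
def toECA (X : PSISpace.{u}) [Nonempty X] : ECA.{u} where
  carrier := Clopens X
  nontriv := ⟨⊥, ⊤, fun h => empty_ne_univ (congrArg (fun U : Clopens X => (U : Set X)) h)⟩
  Ent := X.Ent
  ec0 _ _ _ _ h := ent_sup h
  ec1 _ _ _ _ _ := ent_cut
  ec2 U V W x Y₁ Y₂ Y₃ hR hU _ := by
    obtain ⟨y, h₁, h₃⟩ := inter_nonempty_of_rel hR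
    exact ⟨y, h₃, Or.inl (hU h₁)⟩
  ec3 U W h x hx := by
    have hx' : ({x} : Set X) ⊆ U := by simpa using hx
    obtain ⟨y, rfl, hy⟩ := h x {x} {x} {x} (rel_singleton x) hx' hx'
    exact hy
  ec4 U V W h x Y₁ Y₂ Y₃ hR hV hU := h x Y₂ Y₁ Y₃ (rel_swap hR) hU hV

theorem IsTotal.rel_iff (hX : X.IsTotal) (x : X) {Y₁ Y₂ Y₃ : Set X} (h₁ : IsClosed0 Y₁)
    (h₂ : IsClosed0 Y₂) (h₃ : IsClosed0 Y₃) :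
    X.R x Y₁ Y₂ Y₃ ↔
      ∀ U V W : Clopens X, X.Ent U V W → Y₁ ⊆ U → Y₂ ⊆ V → (Y₃ ∩ W).Nonempty := by
  refine ⟨fun h U V W hE => hE x _ _ _ h, fun h => ?_⟩
  refine (X.isPSI.df2 x Y₁ Y₂ Y₃ h₁ h₂ h₃).2 fun U₁ U₂ U₃ hU₁ hU₂ hU₃ hx => ?_
  by_contra hM
  simp only [Meets, not_or, not_nonempty_iff_eq_empty, ← disjoint_iff_inter_eq_empty] at hM
  obtain ⟨d₁, d₂, d₃⟩ := hM
  -- With the first two sets complemented, the box condition at `x` is an instance of `⊢`. Totality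
  -- carries triples related to any `y` over to `x`.
  have hE : X.Ent (⟨U₁, hU₁⟩ᶜ) (⟨U₂, hU₂⟩ᶜ) ⟨U₃, hU₃⟩ := by
    intro y Z₁ Z₂ Z₃ hR hZ₁ hZ₂
    obtain ⟨k₁, k₂, k₃⟩ := X.isPSI.closed0 _ _ _ _ hR
    rcases hx Z₁ Z₂ Z₃ (hX _ _ _ k₁ k₂ k₃ ⟨y, hR⟩ x) with ⟨w, hw, hw'⟩ | ⟨w, hw, hw'⟩ | h
    · exact absurd hw' (hZ₁ hw)
    · exact absurd hw' (hZ₂ hw)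
    · exact h
  exact not_disjoint_iff_nonempty_inter.2
    (h _ _ _ hE d₁.subset_compl_right d₂.subset_compl_right) d₃

/-- Failure of the inference relation is witnessed by a related triple. -/
theorem not_ent_iff {U V W : Clopens X} :
    ¬ X.Ent U V W ↔ ∃ x Y₁ Y₂ Y₃, X.R x Y₁ Y₂ Y₃ ∧ Y₁ ⊆ U ∧ Y₂ ⊆ V ∧ Disjoint Y₃ (W : Set X) := by
  simp only [Ent, ← not_disjoint_iff_nonempty_inter]
  push Not
  rfl

end PSISpace

/-! ## Preimage homomorphisms -/

section Maps

variable {X₁ X₂ : PSISpace.{u}}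

theorem PullsBackClopens.continuous {f : X₁ → X₂} (hf : PullsBackClopens f) : Continuous f :=
  (isTopologicalBasis_isClopen (X := X₂)).continuous_iff.2 fun U hU => (hf U hU).isOpen

theorem exists_clopen_separating {S : Type u} [TopologicalSpace S] [CompactSpace S] [T2Space S]
    [TotallyDisconnectedSpace S] {Y Z : Set S} (hY : IsClosed Y) (hZ : IsClosed Z)
    (h : Disjoint Y Z) : ∃ U : Clopens S, Y ⊆ U ∧ Disjoint (U : Set S) Z := by
  obtain ⟨U, hU, hYU, hUZ⟩ :=
    exists_clopen_of_closed_subset_open hY hZ.isOpen_compl h.subset_compl_right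
  exact ⟨⟨U, hU⟩, hYU, subset_compl_iff_disjoint_right.1 hUZ⟩

/-- The preimage homomorphism between clopen algebras. -/
def PullsBackClopens.hom {f : X₁ → X₂} (hf : PullsBackClopens f) :
    BoundedLatticeHom (Clopens X₂) (Clopens X₁) where
  toFun U := ⟨f ⁻¹' U, hf U U.isClopen⟩
  map_sup' _ _ := rfl
  map_inf' _ _ := rfl
  map_top' := rfl
  map_bot' := rfl

theorem PullsBackClopens.hom_injective {f g : X₁ → X₂} (hf : PullsBackClopens f)
    (hg : PullsBackClopens g) (h : hf.hom = hg.hom) : f = g := by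
  funext x
  by_contra hne
  obtain ⟨U, hU, hU'⟩ := exists_clopen_separating (S := X₂) (isClosed_singleton (x := f x))
    (isClosed_singleton (x := g x)) (by simpa using hne)
  have h₁ : x ∈ hf.hom U := hU rfl
  rw [h] at h₁
  exact disjoint_left.1 hU' h₁ rfl

/-- Every Boolean homomorphism between clopen algebras is a preimage homomorphism. -/
theorem exists_hom_eq (h : BoundedLatticeHom (Clopens X₂) (Clopens X₁)) :
    ∃ (f : X₁ → X₂) (hf : PullsBackClopens f), hf.hom = h := by
  -- The clopen sets `U` with `x ∈ h U` are closed under intersection and non-empty, so compactness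
  -- gives them a common point, the value at `x`.
  have key : ∀ x : X₁, ∃ y : X₂, ∀ U : Clopens X₂, x ∈ h U → y ∈ U := by
    intro x
    let I := {U : Clopens X₂ // x ∈ h U}
    have : Nonempty I := ⟨⟨⊤, by rw [map_top]; exact mem_univ x⟩⟩
    obtain ⟨y, hy⟩ := IsCompact.nonempty_iInter_of_directed_nonempty_isCompact_isClosed
      (fun U : I => (U.1 : Set X₂))
      (fun U V => ⟨⟨U.1 ⊓ V.1, by rw [map_inf]; exact ⟨U.2, V.2⟩⟩,
        inter_subset_left, inter_subset_right⟩)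
      (fun U => by
        by_contra hne
        have hU : U.1 = ⊥ := Clopens.ext (not_nonempty_iff_eq_empty.1 hne)
        have := U.2
        rw [hU, map_bot] at this
        exact this)
      (fun U => U.1.isClosed.isCompact) (fun U => U.1.isClosed)
    exact ⟨y, fun U hU => mem_iInter.1 hy ⟨U, hU⟩⟩
  choose f hf using key
  have hfU : ∀ (U : Clopens X₂) (x : X₁), f x ∈ U ↔ x ∈ h U := by
    refine fun U x => ⟨fun hx => ?_, hf x U⟩
    by_contra hn
    have hc : x ∈ h Uᶜ := by
      rw [map_compl']
      exact hn
    exact hf x _ hc hx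
  have hp : PullsBackClopens f := by
    intro U hU
    convert (h ⟨U, hU⟩).isClopen using 1
    ext x
    exact hfU ⟨U, hU⟩ x
  exact ⟨f, hp, BoundedLatticeHom.ext fun U => Clopens.ext (Set.ext fun x => hfU U x)⟩

/-- Containment in preimages and meeting them translate to images. Images of closed sets are closed
by compactness, so `rel_iff` applies to the image triple. -/
theorem forth_iff {f : X₁ → X₂} (hf : PullsBackClopens f) (h₂ : X₂.IsTotal) :
    Forth f ↔ ∀ U V W, X₂.Ent U V W → X₁.Ent (hf.hom U) (hf.hom V) (hf.hom W) := by
  constructor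
  · intro h U V W hE x Y₁ Y₂ Y₃ hR hU hV
    obtain ⟨_, ⟨y, hy, rfl⟩, hy'⟩ :=
      hE _ _ _ _ (h x _ _ _ hR) (image_subset_iff.2 hU) (image_subset_iff.2 hV)
    exact ⟨y, hy, hy'⟩
  · intro h x Y₁ Y₂ Y₃ hR
    have hcl : ∀ {Y : Set X₁}, IsClosed0 Y → IsClosed0 (f '' Y) := fun hY =>
      ⟨hf.continuous.isClosedMap _ hY.1, hY.2.image f⟩
    obtain ⟨k₁, k₂, k₃⟩ := X₁.isPSI.closed0 _ _ _ _ hR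
    refine (h₂.rel_iff (f x) (hcl k₁) (hcl k₂) (hcl k₃)).2 fun U V W hE hU hV => ?_
    obtain ⟨y, hy, hy'⟩ :=
      h U V W hE x Y₁ Y₂ Y₃ hR (image_subset_iff (f := f).1 hU) (image_subset_iff (f := f).1 hV)
    exact ⟨f y, mem_image_of_mem f hy, hy'⟩

/-- If the back condition holds, a triple refuting `⊢` in `X₂` is moved to some `f x` by totality
and pulled back. Conversely, the full preimages of the `Zᵢ` serve as witnesses, being the largest
candidates. -/
theorem back_iff {f : X₁ → X₂} (hf : PullsBackClopens f) (h₁ : X₁.IsTotal) (h₂ : X₂.IsTotal)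
    [Nonempty X₁] :
    Back f ↔ ∀ U V W, X₁.Ent (hf.hom U) (hf.hom V) (hf.hom W) → X₂.Ent U V W := by
  constructor
  · intro h U V W
    contrapose
    rw [PSISpace.not_ent_iff, PSISpace.not_ent_iff]
    rintro ⟨y, Z₁, Z₂, Z₃, hR, hU, hV, hW⟩
    obtain ⟨x⟩ := ‹Nonempty X₁›
    obtain ⟨k₁, k₂, k₃⟩ := X₂.isPSI.closed0 _ _ _ _ hR
    obtain ⟨Y₁, Y₂, Y₃, hR', s₁, s₂, s₃⟩ := h x Z₁ Z₂ Z₃ (h₂ _ _ _ k₁ k₂ k₃ ⟨y, hR⟩ _)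
    refine ⟨x, Y₁, Y₂, Y₃, hR', image_subset_iff (f := f).1 (s₁.trans hU),
      image_subset_iff (f := f).1 (s₂.trans hV), ?_⟩
    rw [disjoint_left] at hW ⊢
    exact fun z hz hz' => hW (s₃ (mem_image_of_mem f hz)) hz'
  · intro h x Z₁ Z₂ Z₃ hR
    obtain ⟨k₁, k₂, k₃⟩ := X₂.isPSI.closed0 _ _ _ _ hR
    -- As `f` is a closed map, a clopen neighbourhood of `f ⁻¹' Z` contains the preimage of a clopen
    -- neighbourhood of `Z`. This reduces entailments in `X₁` to those between preimages.
    have hext : ∀ {Z : Set X₂} (P : Clopens X₁), IsClosed Z → f ⁻¹' Z ⊆ P →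
        ∃ U : Clopens X₂, Z ⊆ U ∧ hf.hom U ≤ P := by
      intro Z P hZ hP
      obtain ⟨U, hU, hU'⟩ := exists_clopen_separating (S := X₂) hZ
        (hf.continuous.isClosedMap _ P.isOpen.isClosed_compl) (by
          rw [disjoint_left]
          rintro _ hz ⟨y, hy, rfl⟩
          exact hy (hP hz))
      refine ⟨U, hU, fun y hy => ?_⟩
      by_contra hn
      exact disjoint_left.1 hU' hy ⟨y, hn, rfl⟩
    have main : ∀ P Q T : Clopens X₁, X₁.toECA.Ent P Q T → f ⁻¹' Z₁ ⊆ P → f ⁻¹' Z₂ ⊆ Q →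
        (f ⁻¹' Z₃ ∩ T).Nonempty := by
      intro P Q T hE hP hQ
      by_contra hT
      have hT' : f ⁻¹' Z₃ ⊆ (Tᶜ : Clopens X₁) := fun y hy hy' => hT ⟨y, hy, hy'⟩
      obtain ⟨U, hZU, hUP⟩ := hext P k₁.1 hP
      obtain ⟨V, hZV, hVQ⟩ := hext Q k₂.1 hQ
      obtain ⟨W, hZW, hWT⟩ := hext Tᶜ k₃.1 hT'
      have hTW : T ≤ hf.hom Wᶜ := fun y hy hy' => hWT hy' hy
      obtain ⟨z, hz, hz'⟩ := h U V Wᶜ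
        (ECA.ent_mono (A := X₁.toECA) hUP hVQ hTW hE) _ _ _ _ hR hZU hZV
      exact hz' (hZW hz)
    have hcl : ∀ {Z : Set X₂}, IsClosed0 Z → (f ⁻¹' Z).Nonempty → IsClosed0 (f ⁻¹' Z) :=
      fun hZ hne => ⟨hZ.1.preimage hf.continuous, hne⟩
    -- Since `f` need not be surjective, non-emptiness is extracted from trivial entailments: an
    -- empty preimage would fit below `⊥`, and `(⊥, ⊤) ⊢ ⊥` would yield a point of `⊥`.
    have n₁ : (f ⁻¹' Z₁).Nonempty := by
      by_contra hne
      rw [not_nonempty_iff_eq_empty] at hne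
      obtain ⟨y, -, hy⟩ := main ⊥ ⊤ ⊥ (ECA.ent_of_le_left (A := X₁.toECA) _ le_rfl)
        (by simp [hne]) (subset_univ _)
      exact hy
    have n₂ : (f ⁻¹' Z₂).Nonempty := by
      by_contra hne
      rw [not_nonempty_iff_eq_empty] at hne
      obtain ⟨y, -, hy⟩ := main ⊤ ⊥ ⊥ (ECA.ent_of_le_right (A := X₁.toECA) _ le_rfl)
        (subset_univ _) (by simp [hne])
      exact hy
    have n₃ : (f ⁻¹' Z₃).Nonempty :=
      (main ⊤ ⊤ ⊤ (ECA.ent_of_le_right (A := X₁.toECA) _ le_rfl)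
        (subset_univ _) (subset_univ _)).mono inter_subset_left
    exact ⟨_, _, _, (h₁.rel_iff x (hcl k₁ n₁) (hcl k₂ n₂) (hcl k₃ n₃)).2 main,
      image_preimage_subset f _, image_preimage_subset f _, image_preimage_subset f _⟩

end Maps

/-! ## Stone representation of Boolean algebras -/

/-- The Stone space of a Boolean algebra: its two-valued homomorphisms. -/
def StoneSpace (A : Type u) [BooleanAlgebra A] : Type u :=
  {φ : A → Bool // φ ⊥ = false ∧ φ ⊤ = true ∧ (∀ a b, φ (a ⊔ b) = (φ a || φ b)) ∧
    ∀ a b, φ (a ⊓ b) = (φ a && φ b)}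

namespace StoneSpace

variable (A : Type u) [BooleanAlgebra A]

instance : TopologicalSpace (StoneSpace A) :=
  inferInstanceAs (TopologicalSpace (Subtype _))

instance : T2Space (StoneSpace A) :=
  inferInstanceAs (T2Space (Subtype _))

instance : TotallyDisconnectedSpace (StoneSpace A) :=
  inferInstanceAs (TotallyDisconnectedSpace (Subtype _))

instance : CompactSpace (StoneSpace A) := by
  suffices h : IsClosed {φ : A → Bool | φ ⊥ = false ∧ φ ⊤ = true ∧
      (∀ a b, φ (a ⊔ b) = (φ a || φ b)) ∧ ∀ a b, φ (a ⊓ b) = (φ a && φ b)} from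
    isCompact_iff_compactSpace.1 h.isCompact
  simp only [ofPred_and, ofPred_forall]
  refine (isClosed_eq (by fun_prop) (by fun_prop)).inter
    ((isClosed_eq (by fun_prop) (by fun_prop)).inter
      ((isClosed_iInter fun a => isClosed_iInter fun b => ?_).inter
        (isClosed_iInter fun a => isClosed_iInter fun b => ?_)))
  · exact isClosed_eq (by fun_prop)
      ((continuous_of_discreteTopology (f := fun p : Bool × Bool => (p.1 || p.2))).comp
        (by fun_prop : Continuous fun φ : A → Bool => (φ a, φ b)))
  · exact isClosed_eq (by fun_prop)
      ((continuous_of_discreteTopology (f := fun p : Bool × Bool => (p.1 && p.2))).comp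
        (by fun_prop : Continuous fun φ : A → Bool => (φ a, φ b)))

variable {A}

/-- The homomorphism from a Boolean algebra to the clopen sets of its Stone space. -/
def rep : BoundedLatticeHom A (Clopens (StoneSpace A)) where
  toFun a := ⟨{φ | φ.1 a = true},
    (isClopen_discrete {true}).preimage ((continuous_apply a).comp continuous_subtype_val)⟩
  map_sup' a b := Clopens.ext <| Set.ext fun φ => by
    change φ.1 (a ⊔ b) = true ↔ φ.1 a = true ∨ φ.1 b = true
    rw [φ.2.2.2.1 a b, Bool.or_eq_true]
  map_inf' a b := Clopens.ext <| Set.ext fun φ => by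
    change φ.1 (a ⊓ b) = true ↔ φ.1 a = true ∧ φ.1 b = true
    rw [φ.2.2.2.2 a b, Bool.and_eq_true]
  map_top' := Clopens.ext <| Set.ext fun φ => iff_of_true φ.2.2.1 (mem_univ φ)
  map_bot' := Clopens.ext <| Set.ext fun φ =>
    iff_of_false (Bool.eq_false_iff.1 φ.2.1) (notMem_empty φ)

theorem mem_rep {a : A} {φ : StoneSpace A} : φ ∈ rep a ↔ φ.1 a = true :=
  Iff.rfl

open scoped Classical in
theorem exists_mem_rep {a : A} (ha : a ≠ ⊥) : ∃ φ, φ ∈ rep a := by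
  have hd : Disjoint (Order.PFilter.principal a : Set A) (Order.Ideal.principal (⊥ : A)) := by
    rw [disjoint_left]
    intro b hb hb'
    exact ha (le_bot_iff.1 ((Order.PFilter.mem_principal.1 hb).trans hb'))
  obtain ⟨J, hJ, -, hJa⟩ := DistribLattice.prime_ideal_of_disjoint_filter_ideal hd
  have haJ : a ∉ J := disjoint_left.1 hJa (Order.PFilter.mem_principal.2 le_rfl)
  refine ⟨⟨fun b => decide (b ∉ J), ?_, ?_, fun b c => ?_, fun b c => ?_⟩, ?_⟩
  · simp
  · simpa using fun h : ⊤ ∈ J => haJ (J.lower le_top h)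
  · simp only [Order.Ideal.sup_mem_iff]
    by_cases hb : b ∈ J <;> simp [hb]
  · have : b ⊓ c ∈ J ↔ b ∈ J ∨ c ∈ J :=
      ⟨hJ.mem_or_mem, fun h => h.elim (J.lower inf_le_left) (J.lower inf_le_right)⟩
    simp [this]
  · exact decide_eq_true haJ

theorem rep_le_iff {a b : A} : rep a ≤ rep b ↔ a ≤ b := by
  refine ⟨fun h => ?_, fun h => OrderHomClass.mono rep h⟩
  by_contra hab
  obtain ⟨φ, hφ⟩ := exists_mem_rep (a := a ⊓ bᶜ)
    (by rwa [Ne, ← disjoint_iff, disjoint_compl_right_iff])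
  rw [map_inf, map_compl'] at hφ
  exact hφ.2 (h hφ.1)

theorem exists_rep_of_ne {φ ψ : StoneSpace A} (h : φ ≠ ψ) :
    ∃ a : A, φ ∈ rep a ∧ ψ ∉ rep a := by
  obtain ⟨a, ha⟩ := Function.ne_iff.1 (fun h' => h (Subtype.ext h') : φ.1 ≠ ψ.1)
  by_cases hφ : φ ∈ rep a
  · exact ⟨a, hφ, fun hψ => ha ((mem_rep.1 hφ).trans (mem_rep.1 hψ).symm)⟩
  · refine ⟨aᶜ, by rw [map_compl']; exact hφ, fun hψ => ?_⟩
    rw [map_compl'] at hψ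
    exact ha ((Bool.eq_false_iff.2 hφ).trans (Bool.eq_false_iff.2 hψ).symm)

/-- Compactness is used twice: on the complement of `K`, to find a basic set between a given point
and `K`, and then on `K`, to cover it by finitely many such sets. -/
theorem rep_surjective : Function.Surjective (rep : A → Clopens (StoneSpace A)) := by
  intro K
  have h₁ : ∀ φ ∈ K, ∃ a : A, φ ∈ rep a ∧ rep a ≤ K := by
    intro φ hφ
    have := K.isClopen.compl.isClosed.isCompact.induction_on
      (p := fun L => ∃ a : A, φ ∈ rep a ∧ Disjoint (rep a : Set (StoneSpace A)) L)
      ⟨⊤, by rw [map_top]; exact mem_univ φ, disjoint_empty _⟩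
      (fun s t hst ⟨a, ha, hd⟩ => ⟨a, ha, hd.mono_right hst⟩)
      (fun s t ⟨a, ha, hd⟩ ⟨b, hb, hd'⟩ => ⟨a ⊓ b, by rw [map_inf]; exact ⟨ha, hb⟩, by
        rw [map_inf]
        exact disjoint_union_right.2 ⟨hd.mono_left inter_subset_left,
          hd'.mono_left inter_subset_right⟩⟩)
      (fun ψ hψ => by
        obtain ⟨a, ha, ha'⟩ := exists_rep_of_ne (φ := φ) (ψ := ψ)
          (fun h => hψ (h ▸ hφ))
        exact ⟨_, mem_nhdsWithin_of_mem_nhds ((rep a).isClosed.isOpen_compl.mem_nhds ha'),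
          a, ha, disjoint_compl_right⟩)
    obtain ⟨a, ha, hd⟩ := this
    exact ⟨a, ha, fun ψ hψ => not_not.1 (disjoint_left.1 hd hψ)⟩
  obtain ⟨a, ha, haK⟩ := K.isClosed.isCompact.induction_on
    (p := fun L => ∃ a : A, L ⊆ rep a ∧ rep a ≤ K)
    ⟨⊥, empty_subset _, by rw [map_bot]; exact bot_le⟩
    (fun s t hst ⟨a, ha, hd⟩ => ⟨a, hst.trans ha, hd⟩)
    (fun s t ⟨a, ha, hd⟩ ⟨b, hb, hd'⟩ => ⟨a ⊔ b, by
      rw [map_sup]; exact union_subset_union ha hb, by rw [map_sup]; exact sup_le hd hd'⟩)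
    (fun φ hφ => by
      obtain ⟨a, ha, haK⟩ := h₁ φ hφ
      exact ⟨rep a, mem_nhdsWithin_of_mem_nhds ((rep a).isOpen.mem_nhds ha), a, subset_rfl, haK⟩)
  exact ⟨a, le_antisymm haK ha⟩

theorem exists_rep_separating {Y Z : Set (StoneSpace A)} (hY : IsClosed Y) (hZ : IsClosed Z)
    (h : Disjoint Y Z) : ∃ a : A, Y ⊆ rep a ∧ Disjoint (rep a : Set (StoneSpace A)) Z := by
  obtain ⟨U, hU, hU'⟩ := exists_clopen_separating hY hZ h
  obtain ⟨a, rfl⟩ := rep_surjective U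
  exact ⟨a, hU, hU'⟩

end StoneSpace

/-! ## The total PSI-space of an extended contact algebra -/

namespace ECA

open StoneSpace

variable (A : ECA.{u})

/-- The relation between triples of closed sets of the Stone space dual to `⊢`. -/
def StoneRel (Y₁ Y₂ Y₃ : Set (StoneSpace A)) : Prop :=
  (IsClosed0 Y₁ ∧ IsClosed0 Y₂ ∧ IsClosed0 Y₃) ∧
    ∀ a b c : A, A.Ent a b c → Y₁ ⊆ rep a → Y₂ ⊆ rep b → (Y₃ ∩ rep c).Nonempty

variable {A}

theorem not_stoneRel {Y₁ Y₂ Y₃ : Set (StoneSpace A)} (h₁ : IsClosed0 Y₁) (h₂ : IsClosed0 Y₂)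
    (h₃ : IsClosed0 Y₃) (h : ¬ A.StoneRel Y₁ Y₂ Y₃) :
    ∃ a b c : A, A.Ent a b c ∧ Y₁ ⊆ rep a ∧ Y₂ ⊆ rep b ∧
      Disjoint Y₃ (rep c : Set (StoneSpace A)) := by
  simp only [StoneRel, h₁, h₂, h₃, true_and, and_true, ← not_disjoint_iff_nonempty_inter] at h
  push Not at h
  exact h

theorem StoneRel.not_disjoint {Y₁ Y₂ Y₃ : Set (StoneSpace A)} (h : A.StoneRel Y₁ Y₂ Y₃)
    {a b c : A} (hE : A.Ent a b c) (ha : Y₁ ⊆ rep a) (hb : Y₂ ⊆ rep b)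
    (hc : Disjoint Y₃ (rep c : Set (StoneSpace A))) : False :=
  not_disjoint_iff_nonempty_inter.2 (h.2 a b c hE ha hb) hc

/-- If no point of `Y₁` works, each has a refuting entailment valid on a neighbourhood. By
compactness finitely many of them combine, joining the `a`s and `c`s and meeting the `b`s, into one
that refutes the original triple. -/
theorem StoneRel.exists_left {Y₁ Y₂ Y₃ : Set (StoneSpace A)} (h : A.StoneRel Y₁ Y₂ Y₃) :
    ∃ y ∈ Y₁, A.StoneRel {y} Y₂ Y₃ := by
  by_contra! hn
  obtain ⟨⟨h₁, h₂, h₃⟩, -⟩ := id h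
  have := h₁.1.isCompact.induction_on
    (p := fun L => ∃ a b c : A, A.Ent a b c ∧ L ⊆ rep a ∧ Y₂ ⊆ rep b ∧
      Disjoint Y₃ (rep c : Set (StoneSpace A)))
    ⟨⊥, ⊤, ⊥, ent_of_le_left _ le_rfl, empty_subset _, by rw [map_top]; exact subset_univ _,
      by rw [map_bot]; exact disjoint_empty _⟩
    (fun s t hst ⟨a, b, c, hE, ha, hb, hc⟩ => ⟨a, b, c, hE, hst.trans ha, hb, hc⟩)
    (fun s t ⟨a, b, c, hE, ha, hb, hc⟩ ⟨a', b', c', hE', ha', hb', hc'⟩ =>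
      ⟨a ⊔ a', b ⊓ b', c ⊔ c', ent_sup_left (ent_mono le_rfl inf_le_left le_sup_left hE)
          (ent_mono le_rfl inf_le_right le_sup_right hE'),
        by rw [map_sup]; exact union_subset_union ha ha',
        by rw [map_inf]; exact subset_inter hb hb',
        by rw [map_sup]; exact disjoint_union_right.2 ⟨hc, hc'⟩⟩)
    (fun y hy => by
      obtain ⟨a, b, c, hE, ha, hb, hc⟩ := not_stoneRel (isClosed0_singleton y) h₂ h₃ (hn y hy)
      exact ⟨rep a, mem_nhdsWithin_of_mem_nhds ((rep a).isOpen.mem_nhds (ha rfl)),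
        a, b, c, hE, subset_rfl, hb, hc⟩)
  obtain ⟨a, b, c, hE, ha, hb, hc⟩ := this
  exact h.not_disjoint hE ha hb hc

theorem StoneRel.swap {Y₁ Y₂ Y₃ : Set (StoneSpace A)} (h : A.StoneRel Y₁ Y₂ Y₃) :
    A.StoneRel Y₂ Y₁ Y₃ :=
  ⟨⟨h.1.2.1, h.1.1, h.1.2.2⟩, fun a b c hE ha hb => h.2 b a c (A.ec4 _ _ _ hE) hb ha⟩

/-- If all alternatives fail, the first two refutations give `d` and `e` entailed over `Y₁, Y₂`
whose clopen sets miss `Z` and `W`, hence lie in the closures of the complements. The third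
refutation then cuts against `d` and `e`. -/
theorem StoneRel.cut {Y₁ Y₂ Y₃ Z W : Set (StoneSpace A)} (h : A.StoneRel Y₁ Y₂ Y₃)
    (hZ : IsClosed0 Z) (hW : IsClosed0 W) :
    (A.StoneRel Y₁ Y₂ Z ∨ A.StoneRel Y₁ Y₂ W) ∨ A.StoneRel (closure Zᶜ) (closure Wᶜ) Y₃ := by
  by_contra! hn
  obtain ⟨⟨hnZ, hnW⟩, hn₃⟩ := hn
  obtain ⟨⟨h₁, h₂, h₃⟩, -⟩ := id h
  obtain ⟨a, b, d, hd, ha, hb, hdZ⟩ := not_stoneRel h₁ h₂ hZ hnZ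
  obtain ⟨a', b', e, he, ha', hb', heW⟩ := not_stoneRel h₁ h₂ hW hnW
  have ha₂ : Y₁ ⊆ rep (a ⊓ a') := by rw [map_inf]; exact subset_inter ha ha'
  have hb₂ : Y₂ ⊆ rep (b ⊓ b') := by rw [map_inf]; exact subset_inter hb hb'
  have hd' : A.Ent (a ⊓ a') (b ⊓ b') d := ent_mono inf_le_left inf_le_left le_rfl hd
  have he' : A.Ent (a ⊓ a') (b ⊓ b') e := ent_mono inf_le_right inf_le_right le_rfl he
  have hdsub : (rep d : Set (StoneSpace A)) ⊆ closure Zᶜ :=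
    hdZ.subset_compl_left.trans subset_closure
  have hesub : (rep e : Set (StoneSpace A)) ⊆ closure Wᶜ :=
    heW.subset_compl_left.trans subset_closure
  -- The closures must be non-empty to count as admissible closed sets; anything entailed over `Y₁,
  -- Y₂` meets `Y₃`, so its clopen set is non-empty.
  have hne : ∀ g : A, A.Ent (a ⊓ a') (b ⊓ b') g → (rep g : Set (StoneSpace A)).Nonempty := by
    intro g hg
    obtain ⟨y, -, hy⟩ := h.2 _ _ _ hg ha₂ hb₂
    exact ⟨y, hy⟩
  obtain ⟨p, q, f, hE, hp, hq, hf⟩ := not_stoneRel ⟨isClosed_closure, (hne d hd').mono hdsub⟩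
    ⟨isClosed_closure, (hne e he').mono hesub⟩ h₃ hn₃
  have hdp : d ≤ p := rep_le_iff.1 (hdsub.trans hp)
  have heq : e ≤ q := rep_le_iff.1 (hesub.trans hq)
  exact h.not_disjoint (A.ec1 _ _ _ _ _ hd' he' (ent_mono hdp heq le_rfl hE)) ha₂ hb₂ hf

theorem stoneRel_of_mem {Y₁ Y₂ : Set (StoneSpace A)} (h₁ : IsClosed0 Y₁) (h₂ : IsClosed0 Y₂)
    {x : StoneSpace A} (hx₁ : x ∈ Y₁) (hx₂ : x ∈ Y₂) : A.StoneRel Y₁ Y₁ Y₂ := by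
  refine ⟨⟨h₁, h₁, h₂⟩, fun a b c hE ha hb => ⟨x, hx₂, ?_⟩⟩
  have : a ⊓ b ≤ c := A.ec3 _ _ (ent_mono inf_le_left inf_le_right le_rfl hE)
  refine rep_le_iff.2 this ?_
  rw [map_inf]
  exact ⟨ha hx₁, hb hx₁⟩

theorem StoneRel.inter_nonempty {Y₁ Y₂ Y₃ : Set (StoneSpace A)} (h : A.StoneRel Y₁ Y₂ Y₃) :
    (Y₁ ∩ Y₃).Nonempty := by
  rw [← not_disjoint_iff_nonempty_inter]
  intro hd
  obtain ⟨a, ha, ha'⟩ := exists_rep_separating h.1.1.1 h.1.2.2.1 hd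
  exact h.not_disjoint (ent_of_le_left ⊤ le_rfl) ha (by rw [map_top]; exact subset_univ _) ha'.symm

theorem isPSISpace_stoneRel : IsPSISpace (StoneSpace A) fun _ => A.StoneRel where
  closed0 _ _ _ _ h := h.1
  df1 U₁ U₂ U₃ _ _ _ := by
    -- The relation is the same at every point, so the diamond is everything or empty.
    by_cases h : ∃ Y₁ Y₂ Y₃, A.StoneRel Y₁ Y₂ Y₃ ∧ ¬ Meets Y₁ Y₂ Y₃ U₁ᶜ U₂ᶜ U₃ᶜ
    · convert isClopen_univ using 1
      exact eq_univ_of_forall fun _ => h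
    · convert isClopen_empty using 1
      exact eq_empty_iff_forall_notMem.2 fun _ => h
  df2 x Y₁ Y₂ Y₃ h₁ h₂ h₃ := by
    refine ⟨fun h U₁ U₂ U₃ _ _ _ hx => hx _ _ _ h,
      fun h => ⟨⟨h₁, h₂, h₃⟩, fun a b c hE ha hb => ?_⟩⟩
    -- Each entailment is encoded as a box condition by complementing the first two coordinates.
    have hx : x ∈ boxR (fun _ => A.StoneRel) (rep a : Set _)ᶜ (rep b : Set _)ᶜ (rep c) := by
      intro Z₁ Z₂ Z₃ hZ
      by_contra hM
      simp only [Meets, not_or, not_nonempty_iff_eq_empty, ← disjoint_iff_inter_eq_empty] at hM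
      exact hZ.not_disjoint hE (disjoint_compl_right_iff_subset.1 hM.1)
        (disjoint_compl_right_iff_subset.1 hM.2.1) hM.2.2
    rcases h _ _ _ (rep a).isClopen.compl (rep b).isClopen.compl (rep c).isClopen hx with
      ⟨y, hy, hy'⟩ | ⟨y, hy, hy'⟩ | h'
    · exact absurd (ha hy) hy'
    · exact absurd (hb hy) hy'
    · exact h'
  df3 x Y₁ Y₂ Y₃ h := by
    obtain ⟨y₁, hy₁, h'⟩ := h.exists_left
    obtain ⟨y₂, hy₂, h''⟩ := h'.swap.exists_left
    exact ⟨y₁, hy₁, y₂, hy₂, h''.swap⟩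
  pif1 Y₁ Y₂ Y₃ Z W _ _ _ hZ hW x h := StoneRel.cut h hZ hW
  pif2 Y₁ Y₂ Y₃ _ _ _ hd := by
    refine eq_empty_iff_forall_notMem.2 fun x hx => ?_
    exact (StoneRel.inter_nonempty hx).ne_empty hd
  pif3 Y₁ Y₂ h₁ h₂ x hx := stoneRel_of_mem h₁ h₂ hx.1 hx.2
  pif4 Y₁ Y₂ Y₃ _ _ _ x h := StoneRel.swap h

variable (A)

/-- The PSI-space dual to an extended contact algebra. -/
def toPSISpace : PSISpace.{u} where
  carrier := StoneSpace A
  R _ := A.StoneRel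
  isPSI := isPSISpace_stoneRel

instance : Nonempty A.toPSISpace := by
  obtain ⟨φ, -⟩ := exists_mem_rep (top_ne_bot (α := A))
  exact ⟨φ⟩

theorem isTotal_toPSISpace : A.toPSISpace.IsTotal :=
  fun _ _ _ _ _ _ ⟨_, h⟩ _ => h

/-- The Stone representation as an order isomorphism. -/
noncomputable def repIso : A ≃o Clopens A.toPSISpace :=
  RelIso.ofSurjective (OrderEmbedding.ofMapLEIff (rep : A → Clopens (StoneSpace A))
    fun _ _ => rep_le_iff) rep_surjective

variable {A}

/-- If `(a, b) ⊢ c` fails, the clopen sets of `a`, `b`, `cᶜ` form a related triple by monotonicity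
of `⊢`, and it refutes the entailment in the dual space. They are non-empty because `a = ⊥`, `b = ⊥`
or `c = ⊤` would make `(a, b) ⊢ c` trivial. -/
theorem ent_rep_iff {a b c : A} :
    A.toPSISpace.Ent (A.repIso a) (A.repIso b) (A.repIso c) ↔ A.Ent a b c := by
  constructor
  · intro h
    by_contra hn
    have hne : ∀ {d : A}, d ≠ ⊥ → IsClosed0 (rep d : Set (StoneSpace A)) := fun hd =>
      ⟨(rep _).isClosed, exists_mem_rep hd⟩
    have ha : a ≠ ⊥ := by
      rintro rfl
      exact hn (ent_of_le_left _ bot_le)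
    have hb : b ≠ ⊥ := by
      rintro rfl
      exact hn (ent_of_le_right _ bot_le)
    have hc : cᶜ ≠ ⊥ := by
      rw [Ne, compl_eq_bot]
      rintro rfl
      exact hn (ent_of_le_left _ le_top)
    have hR : A.StoneRel (rep a) (rep b) (rep cᶜ) := by
      refine ⟨⟨hne ha, hne hb, hne hc⟩, fun a' b' c' hE ha' hb' => ?_⟩
      rw [← not_disjoint_iff_nonempty_inter]
      intro hd
      rw [map_compl', Clopens.coe_compl, disjoint_compl_left_iff_subset] at hd
      exact hn (ent_mono (rep_le_iff.1 ha') (rep_le_iff.1 hb') (rep_le_iff.1 hd) hE)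
    obtain ⟨φ⟩ := (inferInstance : Nonempty A.toPSISpace)
    obtain ⟨y, hy, hy'⟩ := h φ _ _ _ hR subset_rfl subset_rfl
    rw [map_compl'] at hy
    exact hy hy'
  · intro h x Y₁ Y₂ Y₃ hR ha hb
    exact hR.2 a b c h ha hb

end ECA

/-! ## The dual equivalences -/

section Equivalences

/-- An order isomorphism of Boolean algebras as a bounded lattice homomorphism. -/
def orderIsoHom {α β : Type u} [BooleanAlgebra α] [BooleanAlgebra β] (e : α ≃o β) :
    BoundedLatticeHom α β where
  toFun := e
  map_sup' := map_sup e
  map_inf' := map_inf e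
  map_top' := map_top e
  map_bot' := map_bot e

theorem isSimilarity_repIso (A : ECA.{u}) :
    IsSimilarity (B := A.toPSISpace.toECA) (orderIsoHom A.repIso) :=
  ⟨fun _ _ _ => ECA.ent_rep_iff.1, fun _ _ _ => ECA.ent_rep_iff.2⟩

/-- Since the inverse is also a similarity, the representation is an isomorphism in all three
categories. -/
theorem isSimilarity_repIso_symm (A : ECA.{u}) :
    IsSimilarity (A := A.toPSISpace.toECA) (orderIsoHom A.repIso.symm) := by
  have key : ∀ U V W : Clopens A.toPSISpace, A.Ent (A.repIso.symm U) (A.repIso.symm V)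
      (A.repIso.symm W) ↔ A.toPSISpace.Ent U V W := by
    intro U V W
    rw [← ECA.ent_rep_iff]
    simp only [OrderIso.apply_symm_apply]
  exact ⟨fun _ _ _ => (key _ _ _).1, fun _ _ _ => (key _ _ _).2⟩

theorem isReflecting_hom_iff {X₁ X₂ : PSISpace.{u}} [Nonempty X₁] [Nonempty X₂] {f : X₁ → X₂}
    (hf : PullsBackClopens f) (h₁ : X₁.IsTotal) (h₂ : X₂.IsTotal) :
    IsReflecting (A := X₂.toECA) (B := X₁.toECA) hf.hom ↔ IsSemiPSIMap f :=
  (back_iff hf h₁ h₂).symm.trans ⟨fun h => ⟨hf, h⟩, fun h => h.2⟩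

theorem isPreserving_hom_iff {X₁ X₂ : PSISpace.{u}} [Nonempty X₁] [Nonempty X₂] {f : X₁ → X₂}
    (hf : PullsBackClopens f) (h₂ : X₂.IsTotal) :
    IsPreserving (A := X₂.toECA) (B := X₁.toECA) hf.hom ↔ IsHemiPSIMap f :=
  (forth_iff hf h₂).symm.trans ⟨fun h => ⟨hf, h⟩, fun h => h.2⟩

instance (X : TPSISp0.{u}) : Nonempty X.obj.toPSISpace := X.property.1

instance (X : TPSISp1.{u}) : Nonempty X.obj.toPSISpace := X.property.1

instance (X : TPSISp2.{u}) : Nonempty X.obj.toPSISpace := X.property.1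

/-- The functor of clopen algebras on total PSI-spaces with semi-PSI maps. -/
def clopenFunctor0 : TPSISp0.{u}ᵒᵖ ⥤ EC0.{u} where
  obj X := ⟨X.unop.obj.toPSISpace.toECA⟩
  map {X Y} f := ⟨f.unop.hom.2.1.hom,
    (isReflecting_hom_iff _ Y.unop.property.2 X.unop.property.2).2 f.unop.hom.2⟩

/-- The functor of clopen algebras on total PSI-spaces with hemi-PSI maps. -/
def clopenFunctor1 : TPSISp1.{u}ᵒᵖ ⥤ EC1.{u} where
  obj X := ⟨X.unop.obj.toPSISpace.toECA⟩
  map {X Y} f := ⟨f.unop.hom.2.1.hom, (isPreserving_hom_iff _ X.unop.property.2).2 f.unop.hom.2⟩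

/-- The functor of clopen algebras on total PSI-spaces with PSI maps. -/
def clopenFunctor2 : TPSISp2.{u}ᵒᵖ ⥤ EC2.{u} where
  obj X := ⟨X.unop.obj.toPSISpace.toECA⟩
  map {X Y} f := ⟨f.unop.hom.2.1.1.hom,
    (isReflecting_hom_iff _ Y.unop.property.2 X.unop.property.2).2 f.unop.hom.2.1,
    (isPreserving_hom_iff _ X.unop.property.2).2 f.unop.hom.2.2⟩

instance : clopenFunctor0.{u}.Faithful where
  map_injective {_ _ f g} h := Quiver.Hom.unop_inj <| ObjectProperty.hom_ext _ <| Subtype.ext <|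
    PullsBackClopens.hom_injective f.unop.hom.2.1 g.unop.hom.2.1 (congrArg Subtype.val h)

instance : clopenFunctor1.{u}.Faithful where
  map_injective {_ _ f g} h := Quiver.Hom.unop_inj <| ObjectProperty.hom_ext _ <| Subtype.ext <|
    PullsBackClopens.hom_injective f.unop.hom.2.1 g.unop.hom.2.1 (congrArg Subtype.val h)

instance : clopenFunctor2.{u}.Faithful where
  map_injective {_ _ f g} h := Quiver.Hom.unop_inj <| ObjectProperty.hom_ext _ <| Subtype.ext <|
    PullsBackClopens.hom_injective f.unop.hom.2.1.1 g.unop.hom.2.1.1 (congrArg Subtype.val h)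

instance : clopenFunctor0.{u}.Full where
  map_surjective {X Y} := by
    rintro ⟨h, hr⟩
    obtain ⟨f, hf, rfl⟩ := exists_hom_eq (X₁ := Y.unop.obj.toPSISpace)
      (X₂ := X.unop.obj.toPSISpace) h
    exact ⟨Quiver.Hom.op (ObjectProperty.homMk ⟨f,
      (isReflecting_hom_iff hf Y.unop.property.2 X.unop.property.2).1 hr⟩), rfl⟩

instance : clopenFunctor1.{u}.Full where
  map_surjective {X Y} := by
    rintro ⟨h, hp⟩
    obtain ⟨f, hf, rfl⟩ := exists_hom_eq (X₁ := Y.unop.obj.toPSISpace)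
      (X₂ := X.unop.obj.toPSISpace) h
    exact ⟨Quiver.Hom.op (ObjectProperty.homMk ⟨f,
      (isPreserving_hom_iff hf X.unop.property.2).1 hp⟩), rfl⟩

instance : clopenFunctor2.{u}.Full where
  map_surjective {X Y} := by
    rintro ⟨h, hr, hp⟩
    obtain ⟨f, hf, rfl⟩ := exists_hom_eq (X₁ := Y.unop.obj.toPSISpace)
      (X₂ := X.unop.obj.toPSISpace) h
    exact ⟨Quiver.Hom.op (ObjectProperty.homMk ⟨f,
      (isReflecting_hom_iff hf Y.unop.property.2 X.unop.property.2).1 hr,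
      (isPreserving_hom_iff hf X.unop.property.2).1 hp⟩), rfl⟩

instance : clopenFunctor0.{u}.EssSurj where
  mem_essImage A := ⟨op ⟨⟨A.toECA.toPSISpace⟩, inferInstance, A.toECA.isTotal_toPSISpace⟩, ⟨{
    hom := ⟨_, (isSimilarity_repIso_symm A.toECA).1⟩
    inv := ⟨_, (isSimilarity_repIso A.toECA).1⟩
    hom_inv_id := Subtype.ext <| BoundedLatticeHom.ext A.toECA.repIso.apply_symm_apply
    inv_hom_id := Subtype.ext <| BoundedLatticeHom.ext A.toECA.repIso.symm_apply_apply }⟩⟩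

instance : clopenFunctor1.{u}.EssSurj where
  mem_essImage A := ⟨op ⟨⟨A.toECA.toPSISpace⟩, inferInstance, A.toECA.isTotal_toPSISpace⟩, ⟨{
    hom := ⟨_, (isSimilarity_repIso_symm A.toECA).2⟩
    inv := ⟨_, (isSimilarity_repIso A.toECA).2⟩
    hom_inv_id := Subtype.ext <| BoundedLatticeHom.ext A.toECA.repIso.apply_symm_apply
    inv_hom_id := Subtype.ext <| BoundedLatticeHom.ext A.toECA.repIso.symm_apply_apply }⟩⟩

instance : clopenFunctor2.{u}.EssSurj where
  mem_essImage A := ⟨op ⟨⟨A.toECA.toPSISpace⟩, inferInstance, A.toECA.isTotal_toPSISpace⟩, ⟨{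
    hom := ⟨_, isSimilarity_repIso_symm A.toECA⟩
    inv := ⟨_, isSimilarity_repIso A.toECA⟩
    hom_inv_id := Subtype.ext <| BoundedLatticeHom.ext A.toECA.repIso.apply_symm_apply
    inv_hom_id := Subtype.ext <| BoundedLatticeHom.ext A.toECA.repIso.symm_apply_apply }⟩⟩

instance : clopenFunctor0.{u}.IsEquivalence where

instance : clopenFunctor1.{u}.IsEquivalence where

instance : clopenFunctor2.{u}.IsEquivalence where

end Equivalences

end ExtContact

theorem mainTheorem12 :
    Nonempty (ExtContact.EC0.{u}ᵒᵖ ≌ ExtContact.TPSISp0.{u}) ∧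
    Nonempty (ExtContact.EC1.{u}ᵒᵖ ≌ ExtContact.TPSISp1.{u}) ∧
    Nonempty (ExtContact.EC2.{u}ᵒᵖ ≌ ExtContact.TPSISp2.{u}) :=
  ⟨⟨ExtContact.clopenFunctor0.asEquivalence.rightOp.symm⟩,
    ⟨ExtContact.clopenFunctor1.asEquivalence.rightOp.symm⟩,
    ⟨ExtContact.clopenFunctor2.asEquivalence.rightOp.symm⟩⟩
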